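/- **Setting.** There are $n$ agents with weights $B=(B_1,\dots,B_n)$, $B_i>0$, $\sum_i B_i=1$, and $m$ item types. In each round $t=1,\dots,T$ an item arrives whose type $j(t)$ is drawn independently and uniformly from $\{1,\dots,m\}$ ($s_j=1/m$). An algorithm, possibly randomized, sees $j(t)$ and all past observations and gives the item to an agent $i(t)$. It then observes the realized utility $u(t)\in\{0,1\}$, which given the past is Bernoulli with mean $v_{i(t),j(t)}$. The value matrix $v\in[0,1]^{n\times m}$ is unknown to the algorithm; $n,m,T,B$ may be known. Let $U_i(T)=\sum_{t\le T:\,i(t)=i}u(t)$, $\mathrm{NSW}(T)=\prod_i U_i(T)^{B_i}$, $$\mathrm{ONSW}=\max\Big\{\prod_{i}\Big(\sum_{j}s_jv_{i,j}x_{i,j}\Big)^{B_i}:\ x_{i,j}\ge 0,\ \sum_i x_{i,j}\le 1\ \text{for all } j\Big\},$$ and $\mathrm{Regret}(T)=T\cdot\mathrm{ONSW}-\mathrm{NSW}(T)$. **Theorem (regret lower bound).** To each $n\ge 2$ and each weight vector $B=(B_1,\dots,B_n)$ as above one can assign a constant $c(B)>0$, depending only on $B$ (hence also on $n$), such that the following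 holds. 1. For all $n\ge 2$, all such $B$, all integers $T\ge m\ge 2$, and every allocation algorithm, there is a model with Bernoulli feedback, uniform item types, weights $B$, and values $v_{i,j}\in\{\tfrac12,\ \tfrac12(1+\sqrt{m/T})\}$ for all $i,j$, in which the algorithm has $$\mathbb E[\mathrm{Regret}(T)]\ \ge\ c(B)\sqrt{mT}.$$ This includes the case $B_i=1/n$ for all $i$, with a constant depending only on $n$. 2. There is an absolute constant $c_0>0$ such that for every $n\ge 2$ some weight vector $B$ with $n$ entries satisfies $c(B)\ge c_0$. For these weights the lower bound in 1 is $c_0\sqrt{mT}$, with a constant independent of $n,m,T$. -/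

import Mathlib

open MeasureTheory

/-- What is recorded in one round: the type of the arriving item, the agent who receives it, and
the realized binary utility of that agent (`true` stands for `1`, `false` for `0`). -/
abbrev FairRound (n m : ℕ) : Type := Fin m × Fin n × Bool

/-- The observations of the first `t` rounds. -/
abbrev FairHistory (n m t : ℕ) : Type := Fin t → FairRound n m

/-- A (possibly randomized) allocation algorithm: in every round it chooses the receiving agent at
random, from a distribution which may depend on all past observations and on the type of the
item that has just arrived. It has no access to the values. -/
def AllocAlgorithm (n m : ℕ) : Type :=
  (t : ℕ) → FairHistory n m t → Fin m → PMF (Fin n)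

/-- An online fair division problem with `n` agents, `m` item types and Bernoulli feedback:
the law of the item types, the weights of the agents, and the ex ante values. -/
structure BernoulliModel (n m : ℕ) where
  itemLaw : PMF (Fin m)
  weight : Fin n → ℝ
  value : Fin n → Fin m → ℝ
  weight_pos : ∀ i, 0 < weight i
  weight_sum : ∑ i, weight i = 1
  value_mem : ∀ i j, value i j ∈ Set.Icc (0 : ℝ) 1

namespace BernoulliModel

variable {n m : ℕ}

/-- The law of the realized utility when agent `i` receives an item of type `j`: the Bernoulli
distribution with mean `M.value i j`. -/
noncomputable def feedback (M : BernoulliModel n m) (i : Fin n) (j : Fin m) : PMF Bool :=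
  PMF.ofFintype
    (fun r => if r then ENNReal.ofReal (M.value i j) else ENNReal.ofReal (1 - M.value i j))
    (by
      have h := M.value_mem i j
      simp [← ENNReal.ofReal_add h.1 (sub_nonneg.2 h.2)])

/-- The law of one round given the past: the type is drawn from the item law, independently of the
past, then the algorithm chooses the agent, then the Bernoulli utility is realized. -/
noncomputable def roundLaw (M : BernoulliModel n m) (alg : AllocAlgorithm n m) (t : ℕ)
    (h : FairHistory n m t) : PMF (FairRound n m) :=
  M.itemLaw.bind fun j => (alg t h j).bind fun i => (M.feedback i j).map fun r => (j, i, r)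

/-- The law of the observations of the first `t` rounds. -/
noncomputable def historyLaw (M : BernoulliModel n m) (alg : AllocAlgorithm n m) :
    (t : ℕ) → PMF (FairHistory n m t)
  | 0 => PMF.pure Fin.elim0
  | t + 1 => (M.historyLaw alg t).bind fun h =>
      (M.roundLaw alg t h).map fun r => Fin.snoc (α := fun _ => FairRound n m) h r

/-- The fractional allocations: `x i j` is the fraction of the items of type `j` that is given to
agent `i`. -/
def feasible (n m : ℕ) : Set (Fin n → Fin m → ℝ) :=
  {x | (∀ j, ∑ i, x i j ≤ 1) ∧ ∀ i j, 0 ≤ x i j}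

/-- The optimal Nash social welfare (per item): the maximum of the weighted geometric mean of the
expected utilities over all fractional allocations. -/
noncomputable def onsw (M : BernoulliModel n m) : ℝ :=
  sSup ((fun x : Fin n → Fin m → ℝ =>
    ∏ i, (∑ j, (M.itemLaw j).toReal * M.value i j * x i j) ^ M.weight i) '' feasible n m)

/-- The cumulative realized utility of agent `i`. -/
def utility {T : ℕ} (h : FairHistory n m T) (i : Fin n) : ℝ :=
  ∑ t, if (h t).2.1 = i ∧ (h t).2.2 = true then 1 else 0

/-- The ex post Nash social welfare. -/
noncomputable def nsw (M : BernoulliModel n m) {T : ℕ} (h : FairHistory n m T) : ℝ :=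
  ∏ i, utility h i ^ M.weight i

/-- The regret of a realized run of length `T`. -/
noncomputable def regret (M : BernoulliModel n m) {T : ℕ} (h : FairHistory n m T) : ℝ :=
  T * M.onsw - M.nsw h

/-- The expected regret of an algorithm over `T` rounds (the space of runs is finite). -/
noncomputable def expectedRegret (M : BernoulliModel n m) (alg : AllocAlgorithm n m) (T : ℕ) : ℝ :=
  ∫ h, M.regret h ∂(M.historyLaw alg T).toMeasure

end BernoulliModel

namespace BernoulliModel

variable {n m : ℕ}

lemma roundLaw_apply (M : BernoulliModel n m) (alg : AllocAlgorithm n m) (t : ℕ)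
    (h : FairHistory n m t) (j : Fin m) (i : Fin n) (r : Bool) :
    M.roundLaw alg t h (j, i, r) = M.itemLaw j * (alg t h j i * M.feedback i j r) := by
  classical
  simp only [roundLaw, PMF.bind_apply, PMF.map_apply, tsum_fintype]
  rw [Finset.sum_eq_single j, Finset.sum_eq_single i, Finset.sum_eq_single r]
  · simp
  · intro r' _ hr'
    simp [Ne.symm hr']
  · simp
  · intro i' _ hi'
    simp [Ne.symm hi']
  · simp
  · intro j' _ hj'
    simp [Ne.symm hj']
  · simp

lemma historyLaw_succ_snoc (M : BernoulliModel n m) (alg : AllocAlgorithm n m) (t : ℕ)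
    (h : FairHistory n m t) (r : FairRound n m) :
    M.historyLaw alg (t + 1) (Fin.snoc (α := fun _ => FairRound n m) h r) =
      M.historyLaw alg t h * M.roundLaw alg t h r := by
  classical
  simp only [historyLaw, PMF.bind_apply, PMF.map_apply, tsum_fintype]
  rw [Finset.sum_eq_single h, Finset.sum_eq_single r]
  · simp
  · intro r' _ hr'
    rw [if_neg]
    intro hc
    exact hr' (Fin.snoc_injective2 hc).2.symm
  · simp
  · intro h' _ hh'
    rw [Finset.sum_eq_zero, mul_zero]
    intro r' _
    rw [if_neg]
    intro hc
    exact hh' (Fin.snoc_injective2 hc).1.symm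
  · simp

lemma feedback_toReal (M : BernoulliModel n m) (i : Fin n) (j : Fin m) (r : Bool) :
    (M.feedback i j r).toReal = if r then M.value i j else 1 - M.value i j := by
  have h := M.value_mem i j
  cases r <;> simp [feedback, h.1, h.2]

/-- The expectation of a real function of the observations of the first `t` rounds. -/
noncomputable def expect (M : BernoulliModel n m) (alg : AllocAlgorithm n m) (t : ℕ)
    (f : FairHistory n m t → ℝ) : ℝ :=
  ∑ h, (M.historyLaw alg t h).toReal * f h

/-- The conditional expectation of a function of the next round, given the past. -/
noncomputable def stepExpect (M : BernoulliModel n m) (alg : AllocAlgorithm n m) (t : ℕ)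
    (h : FairHistory n m t) (g : FairRound n m → ℝ) : ℝ :=
  ∑ j, (M.itemLaw j).toReal * ∑ i, (alg t h j i).toReal *
    ∑ r, (M.feedback i j r).toReal * g (j, i, r)

lemma sum_fairHistory_succ {t : ℕ} (F : FairHistory n m (t + 1) → ℝ) :
    ∑ h, F h = ∑ h : FairHistory n m t, ∑ r : FairRound n m,
      F (Fin.snoc (α := fun _ => FairRound n m) h r) := by
  rw [← Fintype.sum_prod_type', ← (Fin.snocEquiv fun _ : Fin (t + 1) => FairRound n m).sum_comp,
    ← (Equiv.prodComm _ _).sum_comp]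
  rfl

lemma expect_succ (M : BernoulliModel n m) (alg : AllocAlgorithm n m) (t : ℕ)
    (f : FairHistory n m (t + 1) → ℝ) :
    M.expect alg (t + 1) f = M.expect alg t fun h => M.stepExpect alg t h fun r =>
      f (Fin.snoc (α := fun _ => FairRound n m) h r) := by
  unfold expect stepExpect
  rw [sum_fairHistory_succ]
  refine Finset.sum_congr rfl fun h _ => ?_
  simp only [Fintype.sum_prod_type, historyLaw_succ_snoc, roundLaw_apply, ENNReal.toReal_mul,
    Finset.mul_sum]
  refine Finset.sum_congr rfl fun j _ => Finset.sum_congr rfl fun i _ =>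
    Finset.sum_congr rfl fun r _ => ?_
  ring

lemma sum_pmf_toReal {α : Type*} [Fintype α] (p : PMF α) : ∑ a, (p a).toReal = 1 := by
  rw [← ENNReal.toReal_sum fun a _ => p.apply_ne_top a, ← tsum_fintype (L := .unconditional α),
    p.tsum_coe, ENNReal.toReal_one]

section Linear

variable (M : BernoulliModel n m) (alg : AllocAlgorithm n m) (t : ℕ)

lemma expect_const (c : ℝ) : M.expect alg t (fun _ => c) = c := by
  simp [expect, ← Finset.sum_mul, sum_pmf_toReal]

lemma expect_add (f g : FairHistory n m t → ℝ) :
    M.expect alg t (fun h => f h + g h) = M.expect alg t f + M.expect alg t g := by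
  simp [expect, mul_add, Finset.sum_add_distrib]

lemma expect_const_mul (c : ℝ) (f : FairHistory n m t → ℝ) :
    M.expect alg t (fun h => c * f h) = c * M.expect alg t f := by
  simp [expect, Finset.mul_sum, mul_left_comm]

lemma expect_sum {ι : Type*} (s : Finset ι) (f : ι → FairHistory n m t → ℝ) :
    M.expect alg t (fun h => ∑ i ∈ s, f i h) = ∑ i ∈ s, M.expect alg t (f i) := by
  simp only [expect, Finset.mul_sum]
  exact Finset.sum_comm

lemma expect_mono {f g : FairHistory n m t → ℝ} (hfg : ∀ h, f h ≤ g h) :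
    M.expect alg t f ≤ M.expect alg t g :=
  Finset.sum_le_sum fun h _ => mul_le_mul_of_nonneg_left (hfg h) ENNReal.toReal_nonneg

lemma expect_nonneg {f : FairHistory n m t → ℝ} (hf : ∀ h, 0 ≤ f h) : 0 ≤ M.expect alg t f :=
  Finset.sum_nonneg fun h _ => mul_nonneg ENNReal.toReal_nonneg (hf h)

variable (h : FairHistory n m t)

lemma stepExpect_add (f g : FairRound n m → ℝ) :
    M.stepExpect alg t h (fun r => f r + g r) =
      M.stepExpect alg t h f + M.stepExpect alg t h g := by
  simp only [stepExpect, mul_add, Finset.sum_add_distrib]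

lemma stepExpect_const_mul (c : ℝ) (f : FairRound n m → ℝ) :
    M.stepExpect alg t h (fun r => c * f r) = c * M.stepExpect alg t h f := by
  simp only [stepExpect, Finset.mul_sum, mul_left_comm c]

lemma stepExpect_const (c : ℝ) : M.stepExpect alg t h (fun _ => c) = c := by
  simp only [stepExpect, ← Finset.sum_mul, sum_pmf_toReal, one_mul]

end Linear

lemma expectedRegret_eq (M : BernoulliModel n m) (alg : AllocAlgorithm n m) (T : ℕ) :
    M.expectedRegret alg T = T * M.onsw - M.expect alg T M.nsw := by
  unfold expectedRegret
  rw [PMF.integral_eq_sum]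
  simp only [regret, smul_eq_mul, mul_sub, Finset.sum_sub_distrib]
  rw [← Finset.sum_mul, sum_pmf_toReal, one_mul]
  rfl

/-- The expectation of an additive statistic depends on the feedback only through its mean. -/
lemma expect_sum_congr (M : BernoulliModel n m) (alg : AllocAlgorithm n m) (φ ψ : FairRound n m → ℝ)
    (hφψ : ∀ i j, ∑ r, (M.feedback i j r).toReal * φ (j, i, r) =
      ∑ r, (M.feedback i j r).toReal * ψ (j, i, r)) (t : ℕ) :
    M.expect alg t (fun h => ∑ s, φ (h s)) = M.expect alg t (fun h => ∑ s, ψ (h s)) := by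
  induction t with
  | zero => simp
  | succ t ih =>
    simp only [expect_succ, Fin.sum_univ_castSucc, Fin.snoc_castSucc, Fin.snoc_last,
      stepExpect_add, stepExpect_const, expect_add]
    rw [ih]
    simp only [stepExpect, hφψ]

/-- How often agent `i` has received an item of type `j`. -/
noncomputable def count {t : ℕ} (i : Fin n) (j : Fin m) (h : FairHistory n m t) : ℝ :=
  ∑ s, if (h s).1 = j ∧ (h s).2.1 = i then 1 else 0

lemma count_nonneg {t : ℕ} (i : Fin n) (j : Fin m) (h : FairHistory n m t) : 0 ≤ count i j h :=
  Finset.sum_nonneg fun s _ => by split_ifs <;> norm_num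

lemma sum_count {t : ℕ} (h : FairHistory n m t) : ∑ i, ∑ j, count i j h = t := by
  unfold count
  simp_rw [Finset.sum_comm (s := (Finset.univ : Finset (Fin m)))]
  rw [Finset.sum_comm]
  simp [ite_and]

lemma expect_utility (M : BernoulliModel n m) (alg : AllocAlgorithm n m) (t : ℕ) (i : Fin n) :
    M.expect alg t (fun h => utility h i) = ∑ j, M.value i j * M.expect alg t (count i j) := by
  simp_rw [← expect_const_mul]
  rw [← expect_sum]
  have key := M.expect_sum_congr alg
    (fun r => if r.2.1 = i ∧ r.2.2 = true then 1 else 0)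
    (fun r => ∑ j, M.value i j * (if r.1 = j ∧ r.2.1 = i then 1 else 0)) (fun i' j' => by
      by_cases hi : i' = i
      · subst hi
        simp [feedback_toReal, ← add_mul]
      · simp [hi]) t
  unfold utility
  rw [key]
  congr 1
  funext h
  rw [Finset.sum_comm]
  simp only [count, Finset.mul_sum]

/-- Change of measure between two models with the same item law. -/
lemma historyLaw_toReal_eq_mul_prod (M M' : BernoulliModel n m) (alg : AllocAlgorithm n m)
    (ρ : FairRound n m → ℝ) (hlaw : M.itemLaw = M'.itemLaw)
    (hρ : ∀ i j r, (M.feedback i j r).toReal = (M'.feedback i j r).toReal * ρ (j, i, r)) (t : ℕ)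
    (h : FairHistory n m t) :
    (M.historyLaw alg t h).toReal = (M'.historyLaw alg t h).toReal * ∏ s, ρ (h s) := by
  induction t with
  | zero => simp [historyLaw]
  | succ t ih =>
    rw [← Fin.snoc_init_self h]
    generalize Fin.init h = h'
    obtain ⟨j, i, r⟩ := h (Fin.last t)
    have h1 := ih h'
    have h2 := hρ i j r
    erw [historyLaw_succ_snoc, historyLaw_succ_snoc]
    rw [roundLaw_apply, roundLaw_apply]
    simp only [ENNReal.toReal_mul, Fin.prod_univ_castSucc, Fin.snoc_castSucc, Fin.snoc_last]
    rw [h1, h2, hlaw]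
    ring

/-- Moments of a squared likelihood ratio. -/
lemma expect_prod_sq_le (M : BernoulliModel n m) (alg : AllocAlgorithm n m)
    (ρ : FairRound n m → ℝ) (q : ℝ) (hq : 0 ≤ q)
    (h1 : ∀ t h, M.stepExpect alg t h (fun r => ρ r ^ 2) ≤ q) (t : ℕ) :
    M.expect alg t (fun h => ∏ s, ρ (h s) ^ 2) ≤ q ^ t := by
  induction t with
  | zero => simp [expect_const]
  | succ t ih =>
    simp only [expect_succ, Fin.prod_univ_castSucc, Fin.snoc_castSucc, Fin.snoc_last,
      stepExpect_const_mul]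
    calc _ ≤ M.expect alg t (fun h => q * ∏ s, ρ (h s) ^ 2) :=
          M.expect_mono alg t fun h => by
            rw [mul_comm q]
            exact mul_le_mul_of_nonneg_left (h1 t h) (Finset.prod_nonneg fun _ _ => sq_nonneg _)
      _ ≤ _ := by
          rw [expect_const_mul, pow_succ']
          exact mul_le_mul_of_nonneg_left ih hq

lemma expect_sum_mul_prod_sq_le (M : BernoulliModel n m) (alg : AllocAlgorithm n m)
    (ρ φ : FairRound n m → ℝ) (q κ : ℝ) (hq : 1 ≤ q) (hκ : 0 ≤ κ) (hφ : ∀ r, 0 ≤ φ r)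
    (h1 : ∀ t h, M.stepExpect alg t h (fun r => ρ r ^ 2) ≤ q)
    (h2 : ∀ t h, M.stepExpect alg t h (fun r => φ r * ρ r ^ 2) ≤ κ) (t : ℕ) :
    M.expect alg t (fun h => (∑ s, φ (h s)) * ∏ s, ρ (h s) ^ 2) ≤ t * q ^ t * κ := by
  have hq0 : 0 ≤ q := zero_le_one.trans hq
  induction t with
  | zero => simp [expect_const]
  | succ t ih =>
    simp only [expect_succ, Fin.prod_univ_castSucc, Fin.sum_univ_castSucc, Fin.snoc_castSucc,
      Fin.snoc_last]
    calc _ = M.expect alg t (fun h => ((∑ s, φ (h s)) * ∏ s, ρ (h s) ^ 2) *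
              M.stepExpect alg t h (fun r => ρ r ^ 2) +
            (∏ s, ρ (h s) ^ 2) * M.stepExpect alg t h (fun r => φ r * ρ r ^ 2)) := by
          congr 1
          funext h
          rw [← stepExpect_const_mul, ← stepExpect_const_mul, ← stepExpect_add]
          congr 1
          funext r
          ring
      _ ≤ M.expect alg t (fun h => q * ((∑ s, φ (h s)) * ∏ s, ρ (h s) ^ 2) +
            κ * ∏ s, ρ (h s) ^ 2) := by
          refine M.expect_mono alg t fun h => ?_
          have hp : 0 ≤ ∏ s, ρ (h s) ^ 2 := Finset.prod_nonneg fun _ _ => sq_nonneg _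
          have hs : 0 ≤ ∑ s, φ (h s) := Finset.sum_nonneg fun _ _ => hφ _
          rw [mul_comm q, mul_comm κ]
          gcongr
          · exact h1 t h
          · exact h2 t h
      _ ≤ q * (t * q ^ t * κ) + κ * q ^ t := by
          rw [expect_add, expect_const_mul, expect_const_mul]
          gcongr
          exact M.expect_prod_sq_le alg ρ q hq0 h1 t
      _ ≤ _ := by
          have : q ^ t ≤ q ^ (t + 1) := pow_le_pow_right₀ hq (Nat.le_succ t)
          have := mul_le_mul_of_nonneg_left this hκ
          push_cast
          rw [pow_succ'] at *
          nlinarith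

lemma sq_expect_sum_le (M M' : BernoulliModel n m) (alg : AllocAlgorithm n m)
    (ρ φ : FairRound n m → ℝ) (hlaw : M.itemLaw = M'.itemLaw)
    (hρ : ∀ i j r, (M.feedback i j r).toReal = (M'.feedback i j r).toReal * ρ (j, i, r))
    (q κ : ℝ) (hq : 1 ≤ q) (hκ : 0 ≤ κ) (hφ : ∀ r, 0 ≤ φ r)
    (h1 : ∀ t h, M'.stepExpect alg t h (fun r => ρ r ^ 2) ≤ q)
    (h2 : ∀ t h, M'.stepExpect alg t h (fun r => φ r * ρ r ^ 2) ≤ κ) (t : ℕ) :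
    M.expect alg t (fun h => ∑ s, φ (h s)) ^ 2 ≤
      M'.expect alg t (fun h => ∑ s, φ (h s)) * (t * q ^ t * κ) := by
  have hs : ∀ h : FairHistory n m t, 0 ≤ ∑ s, φ (h s) :=
    fun h => Finset.sum_nonneg fun _ _ => hφ _
  refine le_trans ?_ (mul_le_mul_of_nonneg_left
    (M'.expect_sum_mul_prod_sq_le alg ρ φ q κ hq hκ hφ h1 h2 t) (M'.expect_nonneg alg t hs))
  unfold expect
  apply Finset.sum_sq_le_sum_mul_sum_of_sq_le_mul
  · exact fun h _ => mul_nonneg ENNReal.toReal_nonneg (hs h)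
  · exact fun h _ => mul_nonneg ENNReal.toReal_nonneg
      (mul_nonneg (hs h) (Finset.prod_nonneg fun _ _ => sq_nonneg _))
  · intro h _
    simp only [historyLaw_toReal_eq_mul_prod M M' alg ρ hlaw hρ, Finset.prod_pow]
    exact le_of_eq (by ring)

end BernoulliModel

lemma Finset.sum_powersetCard_succ_sum_mem {α : Type*} [Fintype α] [DecidableEq α]
    (f : Finset α → α → ℝ) (k : ℕ) :
    ∑ s ∈ Finset.powersetCard (k + 1) Finset.univ, ∑ j ∈ s, f s j =
      ∑ s ∈ Finset.powersetCard k Finset.univ, ∑ j ∈ sᶜ, f (insert j s) j := by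
  rw [Finset.sum_sigma', Finset.sum_sigma']
  refine Finset.sum_bij' (fun p _ => ⟨p.1.erase p.2, p.2⟩) (fun p _ => ⟨insert p.2 p.1, p.2⟩)
    ?_ ?_ ?_ ?_ ?_
  · rintro ⟨s, j⟩ h
    simp only [Finset.mem_sigma, Finset.mem_powersetCard_univ] at h
    simp [Finset.card_erase_of_mem h.2, h.1]
  · rintro ⟨s, j⟩ h
    simp only [Finset.mem_sigma, Finset.mem_powersetCard_univ, Finset.mem_compl] at h
    simp [Finset.card_insert_of_notMem h.2, h.1]
  · rintro ⟨s, j⟩ h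
    simp only [Finset.mem_sigma] at h
    simp [Finset.insert_erase h.2]
  · rintro ⟨s, j⟩ h
    simp only [Finset.mem_sigma, Finset.mem_compl] at h
    simp [Finset.erase_insert h.2]
  · rintro ⟨s, j⟩ h
    simp only [Finset.mem_sigma] at h
    simp [Finset.insert_erase h.2]

/-- If the mass `∑ j, a θ j` is always large and moving `j` into `θ` cannot destroy `a θ j`,
then for some small `θ` a large part of the mass lies in `θ`. -/
lemma exists_large_sum_mem {m : ℕ} (hm : 2 ≤ m) (a : Finset (Fin m) → Fin m → ℝ) (b T : ℝ)
    (hb : 0 < b) (hb1 : b ≤ 1) (hT : 0 < T)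
    (hmass : ∀ θ, θ.card ≤ m / 2 → b * T / 2 ≤ ∑ j, a θ j)
    (hflip : ∀ θ, ∀ j ∉ θ, a θ j ^ 2 ≤ a (insert j θ) j * (6 * T / m)) :
    ∃ θ : Finset (Fin m), θ.card ≤ m / 2 ∧ b ^ 2 / 288 * T ≤ ∑ j ∈ θ, a θ j := by
  by_contra! hcon
  obtain ⟨k, hk⟩ : ∃ k, m / 2 = k + 1 := ⟨m / 2 - 1, by omega⟩
  have hm0 : (0 : ℝ) < m := by exact_mod_cast (by omega : 0 < m)
  have hlow : ∀ θ ∈ Finset.powersetCard k (Finset.univ : Finset (Fin m)),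
      b ^ 2 * T / 96 ≤ ∑ j ∈ θᶜ, a (insert j θ) j := by
    intro θ hθ
    rw [Finset.mem_powersetCard_univ] at hθ
    have h1 := hmass θ (by omega)
    have h2 := hcon θ (by omega)
    rw [← Finset.sum_add_sum_compl θ] at h1
    have h3 : b * T / 4 ≤ ∑ j ∈ θᶜ, a θ j := by
      have : b ^ 2 * T ≤ b * T := by
        have : b ^ 2 ≤ b := by nlinarith
        gcongr
      nlinarith [mul_pos hb hT]
    have h4 : (∑ j ∈ θᶜ, a θ j) ^ 2 ≤ m * ∑ j ∈ θᶜ, a θ j ^ 2 := by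
      refine sq_sum_le_card_mul_sum_sq.trans ?_
      refine mul_le_mul_of_nonneg_right ?_ (Finset.sum_nonneg fun _ _ => sq_nonneg _)
      exact_mod_cast (Finset.card_le_univ θᶜ).trans (by simp)
    have h5 : ∑ j ∈ θᶜ, a θ j ^ 2 ≤ (∑ j ∈ θᶜ, a (insert j θ) j) * (6 * T / m) := by
      rw [Finset.sum_mul]
      exact Finset.sum_le_sum fun j hj => hflip θ j (by simpa using hj)
    have h6 : (b * T / 4) ^ 2 ≤ (∑ j ∈ θᶜ, a θ j) ^ 2 := by
      have : 0 < b * T := mul_pos hb hT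
      gcongr
    have h7 : (m : ℝ) * ((∑ j ∈ θᶜ, a (insert j θ) j) * (6 * T / m)) =
        (∑ j ∈ θᶜ, a (insert j θ) j) * (6 * T) := by
      field_simp
    have h8 := mul_le_mul_of_nonneg_left h5 hm0.le
    have h9 : (b ^ 2 * T / 96) * (6 * T) ≤ (∑ j ∈ θᶜ, a (insert j θ) j) * (6 * T) := by
      nlinarith
    exact le_of_mul_le_mul_right h9 (by positivity)
  have hsum := Finset.card_nsmul_le_sum _ _ _ hlow
  rw [← Finset.sum_powersetCard_succ_sum_mem] at hsum
  have hup : ∑ s ∈ Finset.powersetCard (k + 1) (Finset.univ : Finset (Fin m)), ∑ j ∈ s, a s j <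
      ∑ s ∈ Finset.powersetCard (k + 1) (Finset.univ : Finset (Fin m)), b ^ 2 / 288 * T := by
    apply Finset.sum_lt_sum_of_nonempty
    · exact Finset.powersetCard_nonempty.2 (by simp; omega)
    · intro s hs
      rw [Finset.mem_powersetCard_univ] at hs
      exact hcon s (by omega)
  simp only [Finset.sum_const, Finset.card_powersetCard, Finset.card_univ, Fintype.card_fin,
    nsmul_eq_mul] at hsum hup
  have hchoose : m.choose (k + 1) ≤ 3 * m.choose k := by
    have h1 := Nat.choose_succ_right_eq m k
    have h2 : m - k ≤ 3 * (k + 1) := by omega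
    have h3 : m.choose (k + 1) * (k + 1) ≤ 3 * m.choose k * (k + 1) := by
      rw [h1]
      calc _ ≤ m.choose k * (3 * (k + 1)) := by gcongr
        _ = _ := by ring
    exact Nat.le_of_mul_le_mul_right h3 (Nat.succ_pos k)
  have hchoose' : (m.choose (k + 1) : ℝ) ≤ 3 * m.choose k := by exact_mod_cast hchoose
  have : (m.choose (k + 1) : ℝ) * (b ^ 2 / 288 * T) ≤ 3 * m.choose k * (b ^ 2 / 288 * T) := by
    gcongr
  linarith

/-- Scaling one factor of a weighted geometric mean. -/
lemma prod_scaled_rpow {n : ℕ} (B : Fin n → ℝ) (hpos : ∀ i, 0 < B i) (hsum : ∑ i, B i = 1)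
    (a : Fin n) (K γ : ℝ) (hK : 0 < K) (hγ : 0 < γ) :
    ∏ i, (K * B i * if i = a then γ else 1) ^ B i = K * γ ^ B a * ∏ i, B i ^ B i := by
  have h1 : ∀ i, (K * B i * if i = a then γ else 1) ^ B i =
      K ^ B i * B i ^ B i * if i = a then γ ^ B a else 1 := by
    intro i
    have := hpos i
    rw [Real.mul_rpow (by positivity) (by split_ifs <;> positivity),
      Real.mul_rpow hK.le this.le]
    split_ifs with h
    · rw [h]
    · simp
  simp_rw [h1, Finset.prod_mul_distrib]
  rw [← Real.rpow_sum_of_pos hK, hsum, Real.rpow_one]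
  simp
  ring

lemma prod_rpow_le_prod_mul_sum {n : ℕ} (B : Fin n → ℝ) (hpos : ∀ i, 0 < B i)
    (hsum : ∑ i, B i = 1) (u p : Fin n → ℝ) (hu : ∀ i, 0 ≤ u i) (hp : ∀ i, 0 < p i) :
    ∏ i, u i ^ B i ≤ (∏ i, p i ^ B i) * ∑ i, B i * (u i / p i) := by
  have h1 : ∏ i, u i ^ B i = (∏ i, p i ^ B i) * ∏ i, (u i / p i) ^ B i := by
    rw [← Finset.prod_mul_distrib]
    refine Finset.prod_congr rfl fun i _ => ?_
    rw [← Real.mul_rpow (hp i).le (div_nonneg (hu i) (hp i).le), mul_div_cancel₀ _ (hp i).ne']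
  rw [h1]
  refine mul_le_mul_of_nonneg_left ?_
    (Finset.prod_nonneg fun i _ => Real.rpow_nonneg (hp i).le _)
  exact Real.geom_mean_le_arith_mean_weighted _ _ _ (fun i _ => (hpos i).le) hsum
    fun i _ => div_nonneg (hu i) (hp i).le

namespace BernoulliModel

variable {n m : ℕ}

lemma le_onsw (M : BernoulliModel n m) (x : Fin n → Fin m → ℝ) (hx : x ∈ feasible n m) :
    ∏ i, (∑ j, (M.itemLaw j).toReal * M.value i j * x i j) ^ M.weight i ≤ M.onsw := by
  refine le_csSup ⟨1, ?_⟩ ⟨x, hx, rfl⟩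
  rintro _ ⟨y, hy, rfl⟩
  refine Finset.prod_le_one (fun i _ => Real.rpow_nonneg (Finset.sum_nonneg fun j _ =>
    mul_nonneg (mul_nonneg ENNReal.toReal_nonneg (M.value_mem i j).1) (hy.2 i j)) _)
    fun i _ => Real.rpow_le_one (Finset.sum_nonneg fun j _ =>
      mul_nonneg (mul_nonneg ENNReal.toReal_nonneg (M.value_mem i j).1) (hy.2 i j)) ?_
      (M.weight_pos i).le
  rw [← sum_pmf_toReal M.itemLaw]
  refine Finset.sum_le_sum fun j _ => ?_
  have hy1 : y i j ≤ 1 :=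
    (Finset.single_le_sum (fun i' _ => hy.2 i' j) (Finset.mem_univ i)).trans (hy.1 j)
  rw [mul_assoc]
  exact mul_le_of_le_one_right ENNReal.toReal_nonneg
    (mul_le_one₀ (M.value_mem i j).2 (hy.2 i j) hy1)

/-- Every agent values every item at `1 / 2`, except that agent `a` values the items whose type is
outside `θ` at `(1 + ε) / 2`. -/
noncomputable def hardModel [NeZero m] (B : Fin n → ℝ) (hpos : ∀ i, 0 < B i)
    (hsum : ∑ i, B i = 1) (ε : ℝ) (hε : ε ∈ Set.Icc (0 : ℝ) 1) (a : Fin n) (θ : Finset (Fin m)) :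
    BernoulliModel n m where
  itemLaw := PMF.uniformOfFintype (Fin m)
  weight := B
  value i j := if i = a ∧ j ∉ θ then 1 / 2 * (1 + ε) else 1 / 2
  weight_pos := hpos
  weight_sum := hsum
  value_mem i j := by
    obtain ⟨h0, h1⟩ := hε
    split_ifs <;> constructor <;> linarith

section Hard

variable [NeZero m] (B : Fin n → ℝ) (hpos : ∀ i, 0 < B i) (hsum : ∑ i, B i = 1) (ε : ℝ)
  (hε : ε ∈ Set.Icc (0 : ℝ) 1) (a : Fin n) (θ : Finset (Fin m))

local notation "H" => hardModel B hpos hsum ε hε a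

lemma hardModel_itemLaw (j : Fin m) : ((H θ).itemLaw j).toReal = 1 / (m : ℝ) := by
  simp [hardModel]

lemma le_hardModel_onsw (ha : B a ≤ 1 / 2) (hθ : θ.card ≤ m / 2) :
    1 / 2 * (1 + ε) ^ B a * ∏ i, B i ^ B i ≤ (H θ).onsw := by
  have hm0 : (0 : ℝ) < m := by exact_mod_cast Nat.pos_of_ne_zero (NeZero.ne m)
  set b := B a with hb
  have hb0 : 0 < b := hpos a
  set p : ℝ := (θᶜ.card : ℝ) / m with hp
  have hcard : (θᶜ.card : ℝ) = m - θ.card := by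
    rw [Finset.card_compl, Nat.cast_sub (Finset.card_le_univ _), Fintype.card_fin]
  have hp2 : 1 / 2 ≤ p := by
    have : (θ.card : ℝ) * 2 ≤ m := by exact_mod_cast (by omega : θ.card * 2 ≤ m)
    rw [hp, le_div_iff₀ hm0, hcard]
    linarith
  have hp0 : 0 < p := by linarith
  set y : Fin m → ℝ := fun j => if j ∈ θ then 0 else b / p with hy
  have hy0 : ∀ j, 0 ≤ y j := fun j => by
    simp only [hy]; split_ifs <;> positivity
  have hy1 : ∀ j, y j ≤ 1 := fun j => by
    simp only [hy]; split_ifs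
    · norm_num
    · rw [div_le_one hp0]; linarith
  have hysum : ∑ j, 1 / (m : ℝ) * y j = b := by
    rw [← Finset.mul_sum, ← Finset.sum_add_sum_compl θ,
      Finset.sum_eq_zero (s := θ) (fun j hj => by simp [hy, hj]),
      Finset.sum_congr (s₁ := θᶜ) (g := fun _ => b / p) rfl
        (fun j hj => by simp [hy, Finset.mem_compl.1 hj])]
    have : (θᶜ.card : ℝ) = p * m := by rw [hp]; field_simp
    rw [Finset.sum_const, nsmul_eq_mul, this]
    field_simp
    ring
  have hone : ∑ j : Fin m, 1 / (m : ℝ) = 1 := by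
    simp [hm0.ne']
  have hrest : ∑ i ∈ Finset.univ.erase a, B i = 1 - b := by
    rw [← hsum, ← Finset.add_sum_erase _ _ (Finset.mem_univ a)]
    ring
  have hb1 : 0 < 1 - b := by linarith
  set x : Fin n → Fin m → ℝ := fun i j => if i = a then y j else B i / (1 - b) * (1 - y j) with hx
  have hfeas : x ∈ feasible n m := by
    constructor
    · intro j
      rw [← Finset.add_sum_erase _ _ (Finset.mem_univ a),
        Finset.sum_congr (s₁ := Finset.univ.erase a) (g := fun i => B i * ((1 - y j) / (1 - b))) rfl
          (fun i hi => by simp only [hx, if_neg (Finset.ne_of_mem_erase hi)]; ring),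
        ← Finset.sum_mul, hrest]
      simp only [hx, if_true]
      rw [mul_div_cancel₀ _ hb1.ne']
      linarith
    · intro i j
      simp only [hx]
      split_ifs
      · exact hy0 j
      · exact mul_nonneg (div_nonneg (hpos i).le hb1.le) (by linarith [hy1 j])
  refine le_trans (le_of_eq ?_) (le_onsw _ x hfeas)
  have h1 := prod_scaled_rpow B hpos hsum a (1 / 2) (1 + ε) (by norm_num) (by linarith [hε.1])
  rw [← h1]
  refine Finset.prod_congr rfl fun i _ => ?_
  change _ = _ ^ B i
  congr 1
  simp_rw [hardModel_itemLaw]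
  by_cases hi : i = a
  · subst hi
    simp only [if_true]
    rw [← hb, ← hysum, mul_comm (1 / 2 : ℝ), mul_assoc, Finset.sum_mul]
    refine Finset.sum_congr rfl fun j _ => ?_
    by_cases hj : j ∈ θ
    · simp [hx, hy, hj]
    · simp [hx, hardModel, hj]
      ring
  · simp only [if_neg hi, hx, hardModel, hi, false_and, if_false]
    have h2 : ∑ j, 1 / (m : ℝ) * (1 - y j) = 1 - b := by
      simp only [mul_sub, mul_one, Finset.sum_sub_distrib]
      rw [hysum, hone]
    have h3 : ∀ j, 1 / (m : ℝ) * (1 / 2) * (B i / (1 - b) * (1 - y j)) =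
        (1 / 2 * (B i / (1 - b))) * (1 / (m : ℝ) * (1 - y j)) := fun j => by ring
    simp_rw [h3]
    rw [← Finset.mul_sum, h2]
    field_simp

/-- The upper bound on the welfare of an algorithm given by supporting prices. -/
lemma hardModel_expect_nsw_le (alg : AllocAlgorithm n m) (T : ℕ) (hT : 0 < T) (α : ℝ)
    (hα : 0 < α) :
    (H θ).expect alg T (H θ).nsw ≤ (1 / 2 * (1 + ε) ^ B a * ∏ i, B i ^ B i) * α ^ B a *
      (T + ∑ j, ((if j ∈ θ then 1 / (1 + ε) else 1) / α - 1) *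
        (H θ).expect alg T (count a j)) := by
  have hT0 : (0 : ℝ) < T := by exact_mod_cast hT
  have hε1 : 0 < 1 + ε := by linarith [hε.1]
  set p : Fin n → ℝ := fun i => T / 2 * B i * if i = a then (1 + ε) * α else 1 with hp
  have hp0 : ∀ i, 0 < p i := fun i => by
    have := hpos i
    simp only [hp]; split_ifs <;> positivity
  have hprod : ∏ i, p i ^ B i = T * ((1 / 2 * (1 + ε) ^ B a * ∏ i, B i ^ B i) * α ^ B a) := by
    rw [hp, prod_scaled_rpow B hpos hsum a (T / 2) _ (by positivity) (by positivity),
      Real.mul_rpow hε1.le hα.le]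
    ring
  have h1 : (H θ).expect alg T (H θ).nsw ≤ (∏ i, p i ^ B i) *
      ∑ i, B i / p i * (H θ).expect alg T (fun h => utility h i) := by
    simp_rw [← expect_const_mul, ← expect_sum]
    rw [← expect_const_mul]
    refine expect_mono _ _ _ fun h => ?_
    refine (prod_rpow_le_prod_mul_sum B hpos hsum _ p (fun i => ?_) hp0).trans (le_of_eq ?_)
    · exact Finset.sum_nonneg fun s _ => by split_ifs <;> norm_num
    · congr 1
      exact Finset.sum_congr rfl fun i _ => by ring
  refine h1.trans (le_of_eq ?_)
  rw [hprod, mul_comm (T : ℝ), mul_assoc]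
  congr 1
  set N : Fin n → Fin m → ℝ := fun i j => (H θ).expect alg T (count i j) with hN
  have hNsum : ∑ i, ∑ j, N i j = T := by
    simp only [hN, ← expect_sum, sum_count, expect_const]
  have h2 : ∀ i, T * (B i / p i * (H θ).expect alg T (fun h => utility h i)) =
      ∑ j, N i j + if i = a then
        ∑ j, ((if j ∈ θ then 1 / (1 + ε) else 1) / α - 1) * N a j else 0 := by
    intro i
    have hBi := (hpos i).ne'
    rw [expect_utility]
    by_cases hi : i = a
    · subst hi
      simp only [if_true, hp]
      rw [← Finset.sum_add_distrib, Finset.mul_sum, Finset.mul_sum]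
      refine Finset.sum_congr rfl fun j _ => ?_
      change _ * (_ * (_ * N i j)) = _
      by_cases hj : j ∈ θ
      · simp [hardModel, hj]
        field_simp
        ring
      · simp [hardModel, hj]
        field_simp
        ring
    · simp only [hi, if_false, hp, hardModel, false_and]
      rw [← Finset.mul_sum, add_zero]
      change _ * (_ * (_ * ∑ j, N i j)) = _
      field_simp
  rw [Finset.mul_sum, Finset.sum_congr rfl fun i _ => h2 i, Finset.sum_add_distrib, hNsum]
  simp [hN]

lemma hardModel_regret_ge_of_bad (ha : B a ≤ 1 / 2) (hθ : θ.card ≤ m / 2)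
    (alg : AllocAlgorithm n m) (T : ℕ) (hT : 0 < T) :
    (∏ i, B i ^ B i) * ε / 4 * ∑ j ∈ θ, (H θ).expect alg T (count a j) ≤
      (H θ).expectedRegret alg T := by
  have hε1 : 0 < 1 + ε := by linarith [hε.1]
  have hP : 0 ≤ ∏ i, B i ^ B i := Finset.prod_nonneg fun i _ => Real.rpow_nonneg (hpos i).le _
  have h1 := hardModel_expect_nsw_le B hpos hsum ε hε a θ alg T hT 1 one_pos
  have h2 := le_hardModel_onsw B hpos hsum ε hε a θ ha hθ
  have h3 : (1 : ℝ) ≤ (1 + ε) ^ B a := Real.one_le_rpow (by linarith [hε.1]) (hpos a).le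
  have h4 : ∑ j, ((if j ∈ θ then 1 / (1 + ε) else 1) / 1 - 1) * (H θ).expect alg T (count a j) =
      -(ε / (1 + ε) * ∑ j ∈ θ, (H θ).expect alg T (count a j)) := by
    rw [Finset.mul_sum, ← Finset.sum_neg_distrib, ← Finset.sum_subset (Finset.subset_univ θ)]
    · refine Finset.sum_congr rfl fun j hj => ?_
      rw [if_pos hj]
      field_simp
      ring
    · intro j _ hj
      simp [hj]
  rw [h4, Real.one_rpow, mul_one] at h1
  rw [expectedRegret_eq]
  have h5 : 0 ≤ ∑ j ∈ θ, (H θ).expect alg T (count a j) :=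
    Finset.sum_nonneg fun j _ => expect_nonneg _ _ _ fun h => count_nonneg _ _ _
  have h6 : ε / 2 ≤ ε / (1 + ε) :=
    div_le_div_of_nonneg_left hε.1 hε1 (by linarith [hε.2])
  have h7 := mul_le_mul_of_nonneg_left h2 (Nat.cast_nonneg (α := ℝ) T)
  calc _ = (1 / 2 * 1 * ∏ i, B i ^ B i) *
        (ε / 2 * ∑ j ∈ θ, (H θ).expect alg T (count a j)) := by ring
    _ ≤ (1 / 2 * (1 + ε) ^ B a * ∏ i, B i ^ B i) *
        (ε / (1 + ε) * ∑ j ∈ θ, (H θ).expect alg T (count a j)) := by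
      have := hε.1
      gcongr
    _ ≤ _ := by linarith

lemma hardModel_regret_ge_of_few (ha : B a ≤ 1 / 2) (hθ : θ.card ≤ m / 2)
    (alg : AllocAlgorithm n m) (T : ℕ) (hT : 0 < T)
    (hfew : ∑ j, (H θ).expect alg T (count a j) ≤ B a * T / 2)
    (hg : (1 / 2 : ℝ) ^ B a * (1 + B a / 2) ≤ 1) :
    (∏ i, B i ^ B i) * (1 / 2 * (1 - (1 / 2 : ℝ) ^ B a * (1 + B a / 2))) * T ≤
      (H θ).expectedRegret alg T := by
  have hε1 : 0 < 1 + ε := by linarith [hε.1]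
  have hP : 0 ≤ ∏ i, B i ^ B i := Finset.prod_nonneg fun i _ => Real.rpow_nonneg (hpos i).le _
  have h1 := hardModel_expect_nsw_le B hpos hsum ε hε a θ alg T hT (1 / 2) (by norm_num)
  have h2 := le_hardModel_onsw B hpos hsum ε hε a θ ha hθ
  have h3 : (1 : ℝ) ≤ (1 + ε) ^ B a := Real.one_le_rpow (by linarith [hε.1]) (hpos a).le
  have h4 : ∑ j, ((if j ∈ θ then 1 / (1 + ε) else 1) / (1 / 2) - 1) *
      (H θ).expect alg T (count a j) ≤ ∑ j, (H θ).expect alg T (count a j) := by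
    refine Finset.sum_le_sum fun j _ => mul_le_of_le_one_left
      (expect_nonneg _ _ _ fun h => count_nonneg _ _ _) ?_
    have : 1 / (1 + ε) ≤ 1 := by rw [div_le_one hε1]; linarith [hε.1]
    split_ifs <;> linarith
  have h7 := mul_le_mul_of_nonneg_left h2 (Nat.cast_nonneg (α := ℝ) T)
  set S := 1 / 2 * (1 + ε) ^ B a * ∏ i, B i ^ B i with hS
  have hS0 : 0 ≤ S := by positivity
  have h8 : (H θ).expect alg T (H θ).nsw ≤ S * (1 / 2 : ℝ) ^ B a * (T + B a * T / 2) := by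
    refine h1.trans (mul_le_mul_of_nonneg_left ?_ (by positivity))
    linarith
  rw [expectedRegret_eq]
  calc _ = (1 / 2 * 1 * ∏ i, B i ^ B i) *
        ((1 - (1 / 2 : ℝ) ^ B a * (1 + B a / 2)) * T) := by ring
    _ ≤ S * ((1 - (1 / 2 : ℝ) ^ B a * (1 + B a / 2)) * T) := by
      have : 0 ≤ 1 - (1 / 2 : ℝ) ^ B a * (1 + B a / 2) := by linarith
      rw [hS]
      gcongr
    _ ≤ _ := by nlinarith

/-- Turning the good type `j` into a bad one cannot make the algorithm stop giving items of this
type to agent `a`. -/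
lemma hardModel_sq_expect_count_le (alg : AllocAlgorithm n m) (T : ℕ)
    (hεT : ε ^ 2 / m * T ≤ 1) (j : Fin m) (hj : j ∉ θ) :
    (H θ).expect alg T (count a j) ^ 2 ≤
      (H (insert j θ)).expect alg T (count a j) * (6 * T / m) := by
  have hm0 : (0 : ℝ) < m := by exact_mod_cast Nat.pos_of_ne_zero (NeZero.ne m)
  set ρ : FairRound n m → ℝ := fun r =>
    if r.1 = j ∧ r.2.1 = a then (if r.2.2 then 1 + ε else 1 - ε) else 1 with hρ
  have hone : ∀ t h, (H (insert j θ)).stepExpect alg t h (fun r =>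
      if r.1 = j ∧ r.2.1 = a then 1 else 0) ≤ 1 / m := by
    intro t h
    calc _ ≤ ∑ j', 1 / (m : ℝ) * (if j' = j then 1 else 0) := by
          unfold stepExpect
          simp_rw [hardModel_itemLaw]
          gcongr with j' _
          by_cases hj' : j' = j
          · rw [if_pos hj']
            refine (Finset.sum_le_sum fun i _ => mul_le_of_le_one_right ENNReal.toReal_nonneg
              ?_).trans_eq (sum_pmf_toReal (alg t h j'))
            refine (Finset.sum_le_sum fun r _ => mul_le_of_le_one_right ENNReal.toReal_nonneg
              ?_).trans_eq (sum_pmf_toReal ((H (insert j θ)).feedback i j'))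
            split_ifs <;> norm_num
          · simp [hj']
      _ = 1 / m := by simp
  have hsq : ∀ t h, (H (insert j θ)).stepExpect alg t h (fun r => ρ r ^ 2) =
      1 + ε ^ 2 * (H (insert j θ)).stepExpect alg t h (fun r =>
        if r.1 = j ∧ r.2.1 = a then 1 else 0) := by
    intro t h
    rw [← stepExpect_const_mul]
    refine Eq.trans ?_ ((stepExpect_add (H (insert j θ)) alg t h (fun _ => 1)
      (fun r => ε ^ 2 * if r.1 = j ∧ r.2.1 = a then 1 else 0)).trans (by rw [stepExpect_const]))
    unfold stepExpect
    refine Finset.sum_congr rfl fun j' _ => ?_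
    congr 1
    refine Finset.sum_congr rfl fun i _ => ?_
    congr 1
    by_cases hc : j' = j ∧ i = a
    · obtain ⟨rfl, rfl⟩ := hc
      simp [hρ, feedback_toReal, hardModel]
      ring
    · simp [hρ, hc]
  have hsq' : ∀ t h, (H (insert j θ)).stepExpect alg t h (fun r =>
      (if r.1 = j ∧ r.2.1 = a then 1 else 0) * ρ r ^ 2) =
      (1 + ε ^ 2) * (H (insert j θ)).stepExpect alg t h (fun r =>
        if r.1 = j ∧ r.2.1 = a then 1 else 0) := by
    intro t h
    rw [← stepExpect_const_mul]
    unfold stepExpect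
    refine Finset.sum_congr rfl fun j' _ => ?_
    congr 1
    refine Finset.sum_congr rfl fun i _ => ?_
    congr 1
    by_cases hc : j' = j ∧ i = a
    · obtain ⟨rfl, rfl⟩ := hc
      simp [hρ, feedback_toReal, hardModel]
      ring
    · simp [hc]
  have key := sq_expect_sum_le (H θ) (H (insert j θ)) alg ρ
    (fun r => if r.1 = j ∧ r.2.1 = a then 1 else 0) rfl (fun i j' r => by
      rw [feedback_toReal, feedback_toReal]
      by_cases hc : j' = j ∧ i = a
      · obtain ⟨rfl, rfl⟩ := hc
        cases r
        · simp [hρ, hardModel, hj]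
          ring
        · simp [hρ, hardModel, hj]
      · have : (H θ).value i j' = (H (insert j θ)).value i j' := by
          simp only [hardModel, Finset.mem_insert]
          by_cases hi : i = a
          · have : j' ≠ j := fun h => hc ⟨h, hi⟩
            simp [this]
          · simp [hi]
        simp [hρ, hc, this])
    (1 + ε ^ 2 / m) (2 / m) (by simp; positivity) (by positivity)
    (fun r => by split_ifs <;> norm_num)
    (fun t h => by
      rw [hsq, div_eq_mul_one_div]
      have := hone t h
      gcongr)
    (fun t h => by
      rw [hsq', div_eq_mul_one_div]
      have h1 : 1 + ε ^ 2 ≤ 2 := by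
        have := hε.1
        have := hε.2
        nlinarith
      calc _ ≤ (1 + ε ^ 2) * (1 / (m : ℝ)) := by
            have := hone t h
            gcongr
        _ ≤ _ := by gcongr) T
  refine key.trans (mul_le_mul_of_nonneg_left ?_ (expect_nonneg _ _ _ fun h => count_nonneg a j h))
  have h1 : (1 + ε ^ 2 / m) ^ T ≤ 3 := by
    calc (1 + ε ^ 2 / m) ^ T ≤ Real.exp (ε ^ 2 / m) ^ T := by
          gcongr
          rw [add_comm]
          exact Real.add_one_le_exp _
      _ = Real.exp (ε ^ 2 / m * T) := by rw [← Real.exp_nat_mul, mul_comm]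
      _ ≤ Real.exp 1 := Real.exp_le_exp.2 hεT
      _ ≤ 3 := by linarith [Real.exp_one_lt_d9]
  calc (T : ℝ) * (1 + ε ^ 2 / m) ^ T * (2 / m) ≤ T * 3 * (2 / m) := by gcongr
    _ = 6 * T / m := by ring

end Hard

end BernoulliModel

namespace BernoulliModel

/-- The constant of the regret lower bound obtained by hiding the values of agent `a`. -/
noncomputable def regretConst {n : ℕ} (B : Fin n → ℝ) (a : Fin n) : ℝ :=
  (∏ i, B i ^ B i) *
    min (B a ^ 2 / 1152) (1 / 2 * (1 - (1 / 2 : ℝ) ^ B a * (1 + B a / 2)))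

lemma half_rpow_mul_lt_one {b : ℝ} (hb : 0 < b) : (1 / 2 : ℝ) ^ b * (1 + b / 2) < 1 := by
  have h1 : (1 / 2 : ℝ) ^ b = (Real.exp (b * Real.log 2))⁻¹ := by
    rw [one_div, Real.inv_rpow (by norm_num), Real.rpow_def_of_pos (by norm_num), mul_comm]
  rw [h1, inv_mul_lt_iff₀ (Real.exp_pos _), mul_one]
  have h2 := Real.add_one_le_exp (b * Real.log 2)
  nlinarith [Real.log_two_gt_d9]

lemma regretConst_pos {n : ℕ} (B : Fin n → ℝ) (hpos : ∀ i, 0 < B i) (a : Fin n) :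
    0 < regretConst B a := by
  have h1 := half_rpow_mul_lt_one (hpos a)
  have h2 := hpos a
  refine mul_pos (Finset.prod_pos fun i _ => Real.rpow_pos_of_pos (hpos i) _) (lt_min ?_ ?_)
  · positivity
  · linarith

lemma exists_regretConst_le {n : ℕ} (B : Fin n → ℝ) (hpos : ∀ i, 0 < B i)
    (hsum : ∑ i, B i = 1) (a : Fin n) (ha : B a ≤ 1 / 2) (m T : ℕ) (hm : 2 ≤ m) (hmT : m ≤ T)
    (alg : AllocAlgorithm n m) :
    ∃ M : BernoulliModel n m,
      (∀ j, (M.itemLaw j).toReal = 1 / (m : ℝ)) ∧ M.weight = B ∧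
      (∀ i j, M.value i j = 1 / 2 ∨
        M.value i j = 1 / 2 * (1 + Real.sqrt ((m : ℝ) / (T : ℝ)))) ∧
      regretConst B a * Real.sqrt ((m : ℝ) * (T : ℝ)) ≤ M.expectedRegret alg T := by
  have : NeZero m := ⟨by omega⟩
  have hm0 : (0 : ℝ) < m := by exact_mod_cast (by omega : 0 < m)
  have hT : 0 < T := by omega
  have hT0 : (0 : ℝ) < T := by exact_mod_cast hT
  have hmT' : (m : ℝ) ≤ T := by exact_mod_cast hmT
  set ε := Real.sqrt ((m : ℝ) / T) with hεdef
  have hε : ε ∈ Set.Icc (0 : ℝ) 1 :=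
    ⟨Real.sqrt_nonneg _, Real.sqrt_le_one.2 ((div_le_one hT0).2 hmT')⟩
  have hε2 : ε ^ 2 = m / T := Real.sq_sqrt (by positivity)
  have hsqrt : Real.sqrt (m * T) = ε * T := by
    rw [show (m : ℝ) * T = m / T * T ^ 2 by field_simp, Real.sqrt_mul (by positivity),
      Real.sqrt_sq hT0.le]
  have hP : 0 ≤ ∏ i, B i ^ B i := Finset.prod_nonneg fun i _ => Real.rpow_nonneg (hpos i).le _
  suffices h : ∃ θ : Finset (Fin m), regretConst B a * Real.sqrt ((m : ℝ) * (T : ℝ)) ≤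
      (hardModel B hpos hsum ε hε a θ).expectedRegret alg T by
    obtain ⟨θ, hθ⟩ := h
    refine ⟨_, fun j => hardModel_itemLaw B hpos hsum ε hε a θ j, rfl, fun i j => ?_, hθ⟩
    simp only [hardModel]
    split_ifs
    · exact Or.inr rfl
    · exact Or.inl rfl
  rw [hsqrt]
  by_cases hfew : ∃ θ : Finset (Fin m), θ.card ≤ m / 2 ∧
      ∑ j, (hardModel B hpos hsum ε hε a θ).expect alg T (count a j) ≤ B a * T / 2
  · obtain ⟨θ, hθ, hle⟩ := hfew
    refine ⟨θ, le_trans ?_ (hardModel_regret_ge_of_few B hpos hsum ε hε a θ ha hθ alg T hT hle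
      (half_rpow_mul_lt_one (hpos a)).le)⟩
    have hg := half_rpow_mul_lt_one (hpos a)
    unfold regretConst
    refine mul_le_mul (mul_le_mul_of_nonneg_left (min_le_right _ _) hP) ?_
      (mul_nonneg hε.1 hT0.le) (mul_nonneg hP (by linarith))
    exact mul_le_of_le_one_left hT0.le hε.2
  · push Not at hfew
    obtain ⟨θ, hθ, hle⟩ := exists_large_sum_mem hm
      (fun θ j => (hardModel B hpos hsum ε hε a θ).expect alg T (count a j)) (B a) T (hpos a)
      (by linarith) hT0 (fun θ hθ => (hfew θ hθ).le)
      (fun θ j hj => hardModel_sq_expect_count_le B hpos hsum ε hε a θ alg T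
        (by rw [hε2]; exact le_of_eq (by field_simp)) j hj)
    refine ⟨θ, le_trans ?_ (hardModel_regret_ge_of_bad B hpos hsum ε hε a θ ha hθ alg T hT)⟩
    have h1 := hε.1
    calc regretConst B a * (ε * T) ≤ (∏ i, B i ^ B i) * (B a ^ 2 / 1152) * (ε * T) := by
          unfold regretConst
          gcongr
          exact min_le_left _ _
      _ = (∏ i, B i ^ B i) * ε / 4 * (B a ^ 2 / 288 * T) := by ring
      _ ≤ _ := by gcongr

lemma exists_weight_le_half {n : ℕ} (hn : 2 ≤ n) (B : Fin n → ℝ) (hpos : ∀ i, 0 < B i)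
    (hsum : ∑ i, B i = 1) : ∃ a, B a ≤ 1 / 2 := by
  by_contra! h
  have h01 : (⟨0, by omega⟩ : Fin n) ≠ ⟨1, by omega⟩ := by simp
  have h1 := Finset.sum_le_sum_of_subset_of_nonneg
    (Finset.subset_univ {(⟨0, by omega⟩ : Fin n), ⟨1, by omega⟩}) fun i _ _ => (hpos i).le
  rw [Finset.sum_pair h01, hsum] at h1
  linarith [h ⟨0, by omega⟩, h ⟨1, by omega⟩]

lemma exp_le_rpow_self {x : ℝ} (hx : 0 < x) : Real.exp (x - 1) ≤ x ^ x := by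
  rw [Real.rpow_def_of_pos hx, Real.exp_le_exp]
  have h1 := Real.one_sub_inv_le_log_of_pos hx
  calc x - 1 = (1 - x⁻¹) * x := by field_simp
    _ ≤ _ := mul_le_mul_of_nonneg_right h1 hx.le

lemma exp_le_sq_rpow_sq {y : ℝ} (hy : 0 < y) : Real.exp (-(2 * y)) ≤ (y ^ 2) ^ (y ^ 2) := by
  rw [Real.rpow_def_of_pos (by positivity), Real.exp_le_exp, Real.log_pow]
  have h1 := Real.one_sub_inv_le_log_of_pos hy
  have h2 := mul_le_mul_of_nonneg_right h1 (sq_nonneg y)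
  have h3 : (1 - y⁻¹) * y ^ 2 = y ^ 2 - y := by field_simp
  push_cast
  nlinarith [sq_nonneg y]

/-- Weights with one entry `1 / 2` whose entropy is bounded independently of their number. -/
lemma exists_weights_low_entropy (n : ℕ) (hn : 2 ≤ n) :
    ∃ B : Fin n → ℝ, (∀ i, 0 < B i) ∧ ∑ i, B i = 1 ∧ (∃ a, B a = 1 / 2) ∧
      Real.exp (-3) ≤ ∏ i, B i ^ B i := by
  obtain ⟨k, rfl⟩ : ∃ k, n = k + 2 := ⟨n - 2, by omega⟩
  have hk0 : (0 : ℝ) ≤ k := Nat.cast_nonneg k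
  set y : ℝ := 1 / (2 * (k + 1)) with hy
  have hy0 : 0 < y := by positivity
  have hky : k * (2 * y) ≤ 1 := by
    rw [hy]
    field_simp
    linarith
  have hy1 : y ≤ 1 / 2 := by
    rw [hy]
    gcongr
    linarith
  set r : ℝ := 1 / 2 - k * y ^ 2 with hr
  have hr0 : 0 < r := by nlinarith
  refine ⟨Fin.cons (1 / 2) (Fin.cons r fun _ => y ^ 2), ?_, ?_, ⟨0, rfl⟩, ?_⟩
  · intro i
    refine Fin.cases ?_ (fun i => Fin.cases ?_ (fun i => ?_) i) i
    · simp
    · simpa using hr0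
    · simpa using by positivity
  · simp [Fin.sum_univ_succ, hr]
    norm_num
  · simp only [Fin.prod_univ_succ, Fin.cons_zero, Fin.cons_succ, Finset.prod_const,
      Finset.card_univ, Fintype.card_fin]
    have h1 := exp_le_rpow_self (x := 1 / 2) (by norm_num)
    have h2 := exp_le_rpow_self hr0
    have h3 : Real.exp (-1) ≤ ((y ^ 2) ^ (y ^ 2)) ^ k := by
      calc Real.exp (-1) ≤ Real.exp (k * -(2 * y)) := Real.exp_le_exp.2 (by linarith)
        _ = Real.exp (-(2 * y)) ^ k := Real.exp_nat_mul _ _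
        _ ≤ _ := by
          gcongr
          exact exp_le_sq_rpow_sq hy0
    calc Real.exp (-3) ≤ Real.exp (1 / 2 - 1) * (Real.exp (r - 1) * Real.exp (-1)) := by
          rw [← Real.exp_add, ← Real.exp_add]
          exact Real.exp_le_exp.2 (by linarith)
      _ ≤ _ := by gcongr

end BernoulliModel

open BernoulliModel in
theorem mainTheorem3 :
    ∃ c : (n : ℕ) → (Fin n → ℝ) → ℝ,
      (∀ (n : ℕ) (B : Fin n → ℝ), 2 ≤ n → (∀ i, 0 < B i) → ∑ i, B i = 1 →
        0 < c n B ∧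
        ∀ m T : ℕ, 2 ≤ m → m ≤ T → ∀ alg : AllocAlgorithm n m,
          ∃ M : BernoulliModel n m,
            (∀ j, (M.itemLaw j).toReal = 1 / (m : ℝ)) ∧
            M.weight = B ∧
            (∀ i j, M.value i j = 1 / 2 ∨
              M.value i j = 1 / 2 * (1 + Real.sqrt ((m : ℝ) / (T : ℝ)))) ∧
            c n B * Real.sqrt ((m : ℝ) * (T : ℝ)) ≤ M.expectedRegret alg T) ∧
      ∃ c₀ : ℝ, 0 < c₀ ∧ ∀ n : ℕ, 2 ≤ n →
        ∃ B : Fin n → ℝ, (∀ i, 0 < B i) ∧ ∑ i, B i = 1 ∧ c₀ ≤ c n B := by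
  classical
  set c : (n : ℕ) → (Fin n → ℝ) → ℝ :=
    fun n B => ⨆ a : Fin n, if B a ≤ 1 / 2 then regretConst B a else 0 with hc
  have hle : ∀ (n : ℕ) (B : Fin n → ℝ) (a : Fin n), B a ≤ 1 / 2 → regretConst B a ≤ c n B := by
    intro n B a ha
    have h := le_ciSup (f := fun a : Fin n => if B a ≤ 1 / 2 then regretConst B a else 0)
      (Set.finite_range _).bddAbove a
    simpa only [if_pos ha] using h
  refine ⟨c, fun n B hn hpos hsum => ?_, ?_⟩
  · obtain ⟨a₀, ha₀⟩ := exists_weight_le_half hn B hpos hsum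
    have hcpos : 0 < c n B := (regretConst_pos B hpos a₀).trans_le (hle n B a₀ ha₀)
    have : Nonempty (Fin n) := ⟨a₀⟩
    obtain ⟨a, ha⟩ := exists_eq_ciSup_of_finite
      (f := fun a : Fin n => if B a ≤ 1 / 2 then regretConst B a else 0)
    change _ = c n B at ha
    have hhalf : B a ≤ 1 / 2 := by
      by_contra h
      rw [if_neg h] at ha
      exact hcpos.ne ha
    rw [if_pos hhalf] at ha
    refine ⟨hcpos, fun m T hm hmT alg => ?_⟩
    rw [← ha]
    exact exists_regretConst_le B hpos hsum a hhalf m T hm hmT alg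
  · have hg := half_rpow_mul_lt_one (b := 1 / 2) (by norm_num)
    set κ : ℝ := min ((1 / 2) ^ 2 / 1152) (1 / 2 * (1 - (1 / 2 : ℝ) ^ (1 / 2 : ℝ) *
      (1 + 1 / 2 / 2))) with hκ
    have hκ0 : 0 < κ := lt_min (by norm_num) (by linarith)
    refine ⟨Real.exp (-3) * κ, by positivity, fun n hn => ?_⟩
    obtain ⟨B, hpos, hsum, ⟨a, ha⟩, hB⟩ := exists_weights_low_entropy n hn
    refine ⟨B, hpos, hsum, le_trans ?_ (hle n B a ha.le)⟩
    unfold regretConst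
    rw [ha]
    gcongr
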